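/- For positive integers $a_1,\dots,a_m$ with even sum, put $N=\tfrac12(a_1+\dots+a_m)$ and let the Kostka number $K(a_1,\dots,a_m)$ be the number of semistandard Young tableaux of shape $(N,N)$ and content $(a_1,\dots,a_m)$: arrays with two rows of $N$ integers each, increasing weakly along each row and strictly down each column, in which each $i=1,\dots,m$ occurs exactly $a_i$ times. In these sequences, $a^\mu$ denotes $\mu$ consecutive entries equal to $a$. Then for all integers $a\ge 3$ and $\mu\ge 2$ with $a\mu$ even, \[ K(a^\mu,\,2a)\;<\;K\bigl(a^\mu,\,(a-1)^2\bigr). \] -/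

import Mathlib

/-- The Young diagram with two rows of length `N`. -/
def twoRowDiagram (N : ℕ) : YoungDiagram :=
  YoungDiagram.ofRowLens (List.replicate 2 N) (List.Pairwise.sortedGE (by simp))

/-- The tableau `T` has content `a = (a₁, …, aₘ)`: the `k`-th letter occurs `aₖ` times, and no
other letter occurs. As Mathlib's tableaux use the letters `0, 1, 2, …`, the letters `1, …, m`
are represented by `0, …, m - 1`. -/
def HasContent {D : YoungDiagram} (T : SemistandardYoungTableau D) (a : List ℕ) : Prop :=
  ∀ k : ℕ, (D.cells.filter fun c => T c.1 c.2 = k).card = a.getD k 0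

/-- The set of semistandard Young tableaux of shape `(N, N)`, with `2N` the sum of `a`, and of
content `a`. If the sum of `a` is odd, there are none. -/
def kostkaTableaux (a : List ℕ) : Set (SemistandardYoungTableau (twoRowDiagram (a.sum / 2))) :=
  {T | HasContent T a}

/-- The two-row Kostka number `K(a₁, …, aₘ)`. -/
noncomputable def kostka (a : List ℕ) : ℕ :=
  (kostkaTableaux a).ncard

theorem mem_twoRowDiagram {N i j : ℕ} : (i, j) ∈ twoRowDiagram N ↔ i < 2 ∧ j < N := by
  unfold twoRowDiagram
  rw [YoungDiagram.mem_ofRowLens]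
  simp only [List.length_replicate, List.getElem_replicate, exists_prop]

/-- The set of tableaux is finite, so that `kostka` really counts its elements. -/
theorem kostkaTableaux_finite (a : List ℕ) : (kostkaTableaux a).Finite := by
  classical
  have hb : ∀ T ∈ kostkaTableaux a, ∀ c ∈ (twoRowDiagram (a.sum / 2)).cells,
      T c.1 c.2 < a.length := by
    intro T hT c hc
    by_contra! h
    have h1 := hT (T c.1 c.2)
    rw [List.getD_eq_default _ _ h, Finset.card_eq_zero] at h1
    have h2 : c ∈ (twoRowDiagram (a.sum / 2)).cells.filter
        fun d => T d.1 d.2 = T c.1 c.2 := by simp [hc]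
    rw [h1] at h2
    simp at h2
  rw [← Set.finite_coe_iff]
  refine Finite.of_injective
    (fun (T : kostkaTableaux a) (c : (twoRowDiagram (a.sum / 2)).cells) =>
      (⟨T.1 c.1.1 c.1.2, hb T.1 T.2 c.1 c.2⟩ : Fin a.length)) ?_
  intro S T h
  apply Subtype.ext
  ext i j
  by_cases hc : (i, j) ∈ (twoRowDiagram (a.sum / 2)).cells
  · have := congrFun h ⟨(i, j), hc⟩
    simpa using this
  · rw [S.1.zeros (by simpa using hc), T.1.zeros (by simpa using hc)]

/-!
Recording the difference of the lengths of the two rows as the letters of a tableau are added one by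
one turns `K(a₁, …, aₘ)` into a number of walks from `0` to `0`, namely the multiplicity of the
trivial module in `V a₁ ⊗ ⋯ ⊗ V aₘ`, where `V n` is the irreducible `sl₂`-module of dimension
`n + 1`. Let `M k` be the multiplicity of `V k` in the `μ`-th tensor power of `V a`, so that
`K(a^μ, b) = M b`, and `K(a^μ, b, c)` is the sum of `M` over the constituents of `V b ⊗ V c`.

For `μ ≥ 2`, the multiplicity per dimension `M k / (k + 1)` decreases along each parity class: for
`μ = 2`, `M` is the indicator function of the even numbers up to `2 a`, and the property passes from
`μ` to `μ + 1`. The constituents of `V b ⊗ V c` have dimensions adding up to `(b + 1) (c + 1)`, so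
`K(a^μ, b, c) ≥ K(a^μ, b + c + 2) (b + 1) (c + 1) / (b + c + 3)`, and the last fraction exceeds `1`
as soon as `b c > 2`.
-/

/-! ### The two-row Pieri rule -/

/-- Some horizontal strip of size `a`, added to a two-row shape whose row lengths differ by `j`,
produces a two-row shape whose row lengths differ by `k`. Equivalently, by Clebsch–Gordan,
`V k` is a constituent of `V a ⊗ V j`, where `V n` is the irreducible `sl₂`-module of
dimension `n + 1`. -/
def IsPieriStep (a j k : ℕ) : Prop :=
  2 ∣ a + j + k ∧ k ≤ j + a ∧ j ≤ k + a ∧ a ≤ j + k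

instance (a j k : ℕ) : Decidable (IsPieriStep a j k) :=
  inferInstanceAs (Decidable (_ ∧ _))

theorem isPieriStep_zero_size {j k : ℕ} : IsPieriStep 0 j k ↔ j = k := by
  unfold IsPieriStep
  omega

theorem isPieriStep_zero_left {a k : ℕ} : IsPieriStep a 0 k ↔ k = a := by
  unfold IsPieriStep
  omega

theorem isPieriStep_zero_right {a j : ℕ} : IsPieriStep a j 0 ↔ j = a := by
  unfold IsPieriStep
  omega

/-- One application of the Pieri rule: the multiplicity of `V k` in `V a ⊗ ⨁ j, (V j) ^ g j`.
The bound `k + a` on the summation index is implied by `IsPieriStep a j k`. -/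
def pieriSum (a : ℕ) (g : ℕ → ℕ) (k : ℕ) : ℕ :=
  ∑ j ∈ Finset.range (k + a + 1) with IsPieriStep a j k, g j

theorem mem_filter_isPieriStep {a j k : ℕ} :
    j ∈ (Finset.range (k + a + 1)).filter (IsPieriStep a · k) ↔ IsPieriStep a j k := by
  rw [Finset.mem_filter, Finset.mem_range]
  exact and_iff_right_of_imp fun h => Nat.lt_succ_of_le h.2.2.1

theorem le_pieriSum {a j k : ℕ} (g : ℕ → ℕ) (h : IsPieriStep a j k) : g j ≤ pieriSum a g k :=
  Finset.single_le_sum (fun _ _ => Nat.zero_le _) (mem_filter_isPieriStep.2 h)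

theorem pieriSum_zero_right (a : ℕ) (g : ℕ → ℕ) : pieriSum a g 0 = g a := by
  simp [pieriSum, isPieriStep_zero_right]

theorem pieriSum_single (a i k : ℕ) :
    pieriSum a (Pi.single i 1) k = if IsPieriStep a i k then 1 else 0 := by
  rw [pieriSum, Finset.sum_pi_single']
  simp only [mem_filter_isPieriStep]

theorem isPieriStep_iff_exists {a j k : ℕ} :
    IsPieriStep a j k ↔ ∃ e < min a k + 1, k + a - 2 * e = j := by
  unfold IsPieriStep
  refine ⟨fun h => ⟨(k + a - j) / 2, by omega, by omega⟩, ?_⟩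
  rintro ⟨e, he, rfl⟩
  omega

theorem pieriSum_eq_sum_range (a : ℕ) (g : ℕ → ℕ) (k : ℕ) :
    pieriSum a g k = ∑ e ∈ Finset.range (min a k + 1), g (k + a - 2 * e) := by
  have hfilter : (Finset.range (k + a + 1)).filter (IsPieriStep a · k) =
      (Finset.range (min a k + 1)).image (k + a - 2 * ·) := by
    ext j
    rw [mem_filter_isPieriStep, isPieriStep_iff_exists]
    simp only [Finset.mem_image, Finset.mem_range]
  rw [pieriSum, hfilter, Finset.sum_image]
  intro e he f hf hef
  simp only [Finset.coe_range, Set.mem_Iio] at he hf hef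
  omega

theorem sum_range_succ_sub_two_mul (g : ℕ → ℕ) (t n : ℕ) :
    ∑ e ∈ Finset.range (n + 1), g (t + 2 - 2 * e) =
      ∑ e ∈ Finset.range n, g (t - 2 * e) + g (t + 2) := by
  rw [Finset.sum_range_succ', Nat.mul_zero, Nat.sub_zero]
  simp only [Nat.mul_add_one, Nat.add_sub_add_right]

theorem pieriSum_add_two_of_le {a k : ℕ} (g : ℕ → ℕ) (h : a ≤ k) :
    pieriSum a g (k + 2) + g (k - a) = pieriSum a g k + g (k + a + 2) := by
  rw [pieriSum_eq_sum_range, pieriSum_eq_sum_range, min_eq_left (by omega), min_eq_left h,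
    Nat.add_right_comm k 2 a, sum_range_succ_sub_two_mul, Finset.sum_range_succ,
    show k + a - 2 * a = k - a by omega]
  exact add_right_comm _ _ _

theorem pieriSum_add_two_of_eq {a k : ℕ} (g : ℕ → ℕ) (h : k + 1 = a) :
    pieriSum a g (k + 2) = pieriSum a g k + g (k + a + 2) := by
  rw [pieriSum_eq_sum_range, pieriSum_eq_sum_range, min_eq_left (by omega),
    min_eq_right (by omega), Nat.add_right_comm k 2 a, sum_range_succ_sub_two_mul, h]

theorem pieriSum_add_two_of_ge {a k : ℕ} (g : ℕ → ℕ) (h : k + 2 ≤ a) :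
    pieriSum a g (k + 2) = pieriSum a g k + g (k + a + 2) + g (a - (k + 2)) := by
  rw [pieriSum_eq_sum_range, pieriSum_eq_sum_range, min_eq_right h, min_eq_right (by omega),
    Nat.add_right_comm k 2 a, sum_range_succ_sub_two_mul, Finset.sum_range_succ,
    show k + a - 2 * (k + 1) = a - (k + 2) by omega]
  exact add_right_comm _ _ _

theorem pieriSum_succ_dim (a k : ℕ) : pieriSum a (· + 1) k = (a + 1) * (k + 1) := by
  induction k using Nat.twoStepInduction with
  | zero => simp [pieriSum_zero_right]
  | one =>
    rcases Nat.eq_zero_or_pos a with rfl | ha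
    · simp [pieriSum_eq_sum_range]
    · rw [pieriSum_eq_sum_range, min_eq_right ha]
      simp only [Finset.sum_range_succ, Finset.sum_range_zero]
      omega
  | more k ih _ =>
    rw [show (a + 1) * (k + 2 + 1) = (a + 1) * (k + 1) + 2 * (a + 1) by ring, ← ih]
    rcases lt_trichotomy (k + 1) a with h | h | h
    · rw [pieriSum_add_two_of_ge _ h]
      omega
    · rw [pieriSum_add_two_of_eq _ h]
      omega
    · have := pieriSum_add_two_of_le (· + 1) (Nat.le_of_lt_succ h)
      omega

/-- The multiplicity per dimension `g k / (k + 1)` is antitone along each parity class. The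
denominators are cleared, to stay in `ℕ`. -/
def DimAntitone (g : ℕ → ℕ) : Prop :=
  ∀ k, g (k + 2) * (k + 1) ≤ g k * (k + 3)

theorem DimAntitone.mul_le_mul {g : ℕ → ℕ} (hg : DimAntitone g) {j k : ℕ} (hjk : j ≤ k)
    (hpar : 2 ∣ j + k) : g k * (j + 1) ≤ g j * (k + 1) := by
  obtain ⟨n, rfl⟩ : ∃ n, k = j + 2 * n := ⟨(k - j) / 2, by omega⟩
  clear hjk hpar
  induction n with
  | zero => rfl
  | succ n ih =>
    refine Nat.le_of_mul_le_mul_right ?_ (Nat.succ_pos (j + 2 * n))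
    calc g (j + 2 * n + 2) * (j + 1) * (j + 2 * n + 1)
        = g (j + 2 * n + 2) * (j + 2 * n + 1) * (j + 1) := mul_right_comm _ _ _
      _ ≤ g (j + 2 * n) * (j + 2 * n + 3) * (j + 1) := Nat.mul_le_mul_right _ (hg _)
      _ = g (j + 2 * n) * (j + 1) * (j + 2 * n + 3) := mul_right_comm _ _ _
      _ ≤ g j * (j + 2 * n + 1) * (j + 2 * n + 3) := Nat.mul_le_mul_right _ ih
      _ = g j * (j + 2 * n + 3) * (j + 2 * n + 1) := mul_right_comm _ _ _

theorem DimAntitone.mul_le_pieriSum {g : ℕ → ℕ} (hg : DimAntitone g) (a k : ℕ) :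
    g (k + a + 2) * ((a + 1) * (k + 1)) ≤ pieriSum a g k * (k + a + 3) := by
  rw [← pieriSum_succ_dim, pieriSum, pieriSum, Finset.mul_sum, Finset.sum_mul]
  refine Finset.sum_le_sum fun j hj => ?_
  obtain ⟨hpar, -, hle, -⟩ := mem_filter_isPieriStep.1 hj
  exact hg.mul_le_mul (by omega) (by omega)

theorem DimAntitone.lt_pieriSum {g : ℕ → ℕ} (hg : DimAntitone g) {a k : ℕ} (hak : 2 < a * k)
    (hpos : 0 < pieriSum a g k) : g (k + a + 2) < pieriSum a g k := by
  by_contra! hle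
  have hdim : k + a + 3 < (a + 1) * (k + 1) := by linarith
  have := hg.mul_le_pieriSum a k
  have : g (k + a + 2) * (k + a + 3) < g (k + a + 2) * ((a + 1) * (k + 1)) :=
    Nat.mul_lt_mul_of_pos_left hdim (hpos.trans_le hle)
  have := Nat.mul_le_mul_right (k + a + 3) hle
  omega

/-- The sum `g (a + d) + g (a - d)` over the pair of points at distance `d ≤ a` from `a` is
antitone in `d` along each parity class. This is what makes the Pieri rule preserve `DimAntitone`
below `a`, where the reflection of the summation range at `a` produces such pairs. -/
def PairSumAntitone (a : ℕ) (g : ℕ → ℕ) : Prop :=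
  ∀ d, d + 2 ≤ a → g (a + (d + 2)) + g (a - (d + 2)) ≤ g (a + d) + g (a - d)

theorem PairSumAntitone.le_of_le {a : ℕ} {g : ℕ → ℕ} (hg : PairSumAntitone a g) {d s : ℕ}
    (hds : d ≤ s) (hpar : 2 ∣ d + s) (hs : s ≤ a) :
    g (a + s) + g (a - s) ≤ g (a + d) + g (a - d) := by
  obtain ⟨n, rfl⟩ : ∃ n, s = d + 2 * n := ⟨(s - d) / 2, by omega⟩
  clear hds hpar
  induction n with
  | zero => rfl
  | succ n ih => exact (hg (d + 2 * n) hs).trans (ih (by omega))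

theorem DimAntitone.le_two_mul_add {g : ℕ → ℕ} (hg : DimAntitone g) {a d : ℕ} (hd : d + 2 ≤ a) :
    g (2 * a + d + 2) ≤ 2 * g d + g (2 * a - d) := by
  have hlow := hg.mul_le_mul (j := d) (k := 2 * a + d + 2) (by omega) (by omega)
  have hhigh := hg.mul_le_mul (j := 2 * a - d) (k := 2 * a + d + 2) (by omega) (by omega)
  refine Nat.le_of_mul_le_mul_right ?_ (Nat.succ_pos (2 * a + d + 2))
  calc g (2 * a + d + 2) * (2 * a + d + 3)
      = 2 * (g (2 * a + d + 2) * (d + 1)) + g (2 * a + d + 2) * (2 * a - d + 1) := by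
        rw [show 2 * a + d + 3 = 2 * (d + 1) + (2 * a - d + 1) by omega]
        ring
    _ ≤ 2 * (g d * (2 * a + d + 3)) + g (2 * a - d) * (2 * a + d + 3) := by gcongr
    _ = (2 * g d + g (2 * a - d)) * (2 * a + d + 3) := by ring

theorem DimAntitone.pairSumAntitone_pieriSum {g : ℕ → ℕ} (hg : DimAntitone g) (a : ℕ) :
    PairSumAntitone a (pieriSum a g) := by
  intro d hd
  have hup := pieriSum_add_two_of_le (a := a) (k := a + d) g (by omega)
  have hdown := pieriSum_add_two_of_ge (a := a) (k := a - (d + 2)) g (by omega)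
  have hwindow := hg.le_two_mul_add hd
  rw [show a + d - a = d by omega, show a + d + a + 2 = 2 * a + d + 2 by omega] at hup
  rw [show a - (d + 2) + 2 = a - d by omega, show a - (d + 2) + a + 2 = 2 * a - d by omega,
    show a - (a - d) = d by omega] at hdown
  rw [← add_assoc]
  omega

theorem PairSumAntitone.mul_le_pieriSum {a : ℕ} {g : ℕ → ℕ} (hg : PairSumAntitone a g) {k : ℕ}
    (hk : k + 2 ≤ a) :
    (k + 1) * (g (a + (k + 2)) + g (a - (k + 2))) ≤ 2 * pieriSum a g k := by
  have hpair : ∀ e ∈ Finset.range (k + 1), g (a + (k + 2)) + g (a - (k + 2)) ≤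
      g (k + a - 2 * e) + g (k + a - 2 * (k + 1 - 1 - e)) := by
    intro e he
    rw [Finset.mem_range] at he
    rcases le_total (2 * e) k with h | h
    · rw [show k + a - 2 * e = a + (k - 2 * e) by omega,
        show k + a - 2 * (k + 1 - 1 - e) = a - (k - 2 * e) by omega]
      exact hg.le_of_le (by omega) (by omega) hk
    · rw [add_comm (g (k + a - _)), show k + a - 2 * e = a - (2 * e - k) by omega,
        show k + a - 2 * (k + 1 - 1 - e) = a + (2 * e - k) by omega]
      exact hg.le_of_le (by omega) (by omega) hk
  calc (k + 1) * (g (a + (k + 2)) + g (a - (k + 2)))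
      ≤ ∑ e ∈ Finset.range (k + 1),
          (g (k + a - 2 * e) + g (k + a - 2 * (k + 1 - 1 - e))) := by
        simpa using Finset.card_nsmul_le_sum _ _ _ hpair
    _ = 2 * pieriSum a g k := by
        rw [Finset.sum_add_distrib,
          Finset.sum_range_reflect (fun e => g (k + a - 2 * e)) (k + 1), ← two_mul,
          pieriSum_eq_sum_range, min_eq_right (by omega)]

theorem DimAntitone.pieriSum_add_two_mul_le_of_le {a k : ℕ} {g : ℕ → ℕ} (hg : DimAntitone g)
    (hak : a ≤ k) :
    pieriSum a g (k + 2) * (k + 1) ≤ pieriSum a g k * (k + 3) := by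
  have hstep := pieriSum_add_two_of_le g hak
  have hlow := hg.mul_le_mul (j := k - a) (k := k + a + 2) (by omega) (by omega)
  have havg := hg.mul_le_pieriSum a k
  have htop : (k + 1) * g (k + a + 2) ≤ 2 * pieriSum a g k + (k + 1) * g (k - a) := by
    refine Nat.le_of_mul_le_mul_right ?_ (Nat.succ_pos (k + a + 2))
    calc (k + 1) * g (k + a + 2) * (k + a + 3)
        = 2 * (g (k + a + 2) * ((a + 1) * (k + 1))) +
            (k + 1) * (g (k + a + 2) * (k - a + 1)) := by
          rw [show k + a + 3 = 2 * (a + 1) + (k - a + 1) by omega]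
          ring
      _ ≤ 2 * (pieriSum a g k * (k + a + 3)) + (k + 1) * (g (k - a) * (k + a + 3)) := by gcongr
      _ = (2 * pieriSum a g k + (k + 1) * g (k - a)) * (k + a + 3) := by ring
  have hscaled := congrArg (· * (k + 1)) hstep
  linarith

theorem DimAntitone.pieriSum_add_two_mul_le_of_eq {a k : ℕ} {g : ℕ → ℕ} (hg : DimAntitone g)
    (hak : k + 1 = a) :
    pieriSum a g (k + 2) * (k + 1) ≤ pieriSum a g k * (k + 3) := by
  have havg := hg.mul_le_pieriSum a k
  subst hak
  have htop : g (k + (k + 1) + 2) * (k + 1) ≤ 2 * pieriSum (k + 1) g k :=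
    Nat.le_of_mul_le_mul_right (by linarith) (Nat.succ_pos (k + 1))
  rw [pieriSum_add_two_of_eq g rfl]
  linarith

theorem PairSumAntitone.pieriSum_add_two_mul_le_of_ge {a k : ℕ} {g : ℕ → ℕ}
    (hg : PairSumAntitone a g) (hak : k + 2 ≤ a) :
    pieriSum a g (k + 2) * (k + 1) ≤ pieriSum a g k * (k + 3) := by
  have hpair := hg.mul_le_pieriSum hak
  rw [pieriSum_add_two_of_ge g hak, show k + a + 2 = a + (k + 2) by omega]
  linarith

theorem DimAntitone.pieriSum {a : ℕ} {g : ℕ → ℕ} (hg : DimAntitone g)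
    (hpair : PairSumAntitone a g) : DimAntitone (pieriSum a g) := by
  intro k
  rcases lt_trichotomy (k + 1) a with h | h | h
  · exact hpair.pieriSum_add_two_mul_le_of_ge h
  · exact hg.pieriSum_add_two_mul_le_of_eq h
  · exact hg.pieriSum_add_two_mul_le_of_le (Nat.le_of_lt_succ h)

/-- The multiplicity of `V k` in the tensor product of the `V a` for `a` in `l`; `Pi.single 0 1`
stands for the trivial module `V 0`. -/
def pieriCount (l : List ℕ) : ℕ → ℕ :=
  l.foldl (fun g a => pieriSum a g) (Pi.single 0 1)

theorem pieriCount_append_singleton (l : List ℕ) (b : ℕ) :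
    pieriCount (l ++ [b]) = pieriSum b (pieriCount l) := by
  simp only [pieriCount, List.foldl_append, List.foldl_cons, List.foldl_nil]

theorem pieriCount_replicate_succ (a μ : ℕ) :
    pieriCount (List.replicate (μ + 1) a) = pieriSum a (pieriCount (List.replicate μ a)) := by
  rw [List.replicate_succ', pieriCount_append_singleton]

theorem pieriCount_sum_pos (l : List ℕ) : 0 < pieriCount l l.sum := by
  induction l using List.reverseRecOn with
  | nil => exact Nat.one_pos
  | append_singleton l b ih =>
    rw [pieriCount_append_singleton, List.sum_append_nat, List.sum_singleton]
    exact ih.trans_le (le_pieriSum _ (by unfold IsPieriStep; omega))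

theorem pieriCount_replicate_two (a k : ℕ) :
    pieriCount (List.replicate 2 a) k = if IsPieriStep a a k then 1 else 0 := by
  have hone : pieriSum a (Pi.single 0 1) = Pi.single a 1 := by
    funext j
    simp only [pieriSum_single, Pi.single_apply, isPieriStep_zero_left]
  rw [← pieriSum_single, ← hone]
  rfl

theorem pieriCount_replicate_two_le {a j k : ℕ} (h : IsPieriStep a a j → IsPieriStep a a k) :
    pieriCount (List.replicate 2 a) j ≤ pieriCount (List.replicate 2 a) k := by
  rw [pieriCount_replicate_two, pieriCount_replicate_two]
  split_ifs <;> tauto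

theorem dimAntitone_pieriCount_replicate_two (a : ℕ) :
    DimAntitone (pieriCount (List.replicate 2 a)) := fun k =>
  Nat.mul_le_mul (pieriCount_replicate_two_le (by unfold IsPieriStep; omega)) (by omega)

theorem pairSumAntitone_pieriCount_replicate_two (a : ℕ) :
    PairSumAntitone a (pieriCount (List.replicate 2 a)) := fun d hd =>
  Nat.add_le_add (pieriCount_replicate_two_le (by unfold IsPieriStep; omega))
    (pieriCount_replicate_two_le (by unfold IsPieriStep; omega))

theorem dimAntitone_pieriCount_replicate (a : ℕ) {μ : ℕ} (hμ : 2 ≤ μ) :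
    DimAntitone (pieriCount (List.replicate μ a)) := by
  suffices h : DimAntitone (pieriCount (List.replicate μ a)) ∧
      PairSumAntitone a (pieriCount (List.replicate μ a)) from h.1
  induction μ, hμ using Nat.le_induction with
  | base =>
    exact ⟨dimAntitone_pieriCount_replicate_two a, pairSumAntitone_pieriCount_replicate_two a⟩
  | succ μ _ ih =>
    rw [pieriCount_replicate_succ]
    exact ⟨ih.1.pieriSum ih.2, ih.1.pairSumAntitone_pieriSum a⟩

theorem pieriCount_replicate_pos {a μ j : ℕ} (hμ : 2 ≤ μ) (hj : j ≤ μ * a)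
    (hpar : 2 ∣ j + μ * a) : 0 < pieriCount (List.replicate μ a) j := by
  have htop := pieriCount_sum_pos (List.replicate μ a)
  rw [List.sum_replicate, smul_eq_mul] at htop
  have := (dimAntitone_pieriCount_replicate a hμ).mul_le_mul hj hpar
  exact Nat.pos_of_mul_pos_right (lt_of_lt_of_le (Nat.mul_pos htop (Nat.succ_pos j)) this)

theorem pieriCount_replicate_add_two_lt {a μ b c : ℕ} (hμ : 2 ≤ μ) (hbc : 2 < b * c)
    (hpar : Even (μ * a + (b + c))) (hb : b ≤ c + μ * a) (hc : c ≤ b + μ * a) :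
    pieriCount (List.replicate μ a) (c + b + 2) <
      pieriSum b (pieriCount (List.replicate μ a)) c := by
  rw [even_iff_two_dvd] at hpar
  have hpos : 0 < pieriCount (List.replicate μ a) (max b c - min b c) :=
    pieriCount_replicate_pos hμ (by omega) (by omega)
  have hstep : IsPieriStep b (max b c - min b c) c := by
    unfold IsPieriStep
    omega
  exact (dimAntitone_pieriCount_replicate a hμ).lt_pieriSum hbc
    (hpos.trans_le (le_pieriSum _ hstep))

/-! ### Walks of Pieri steps -/

/-- The walks that start at `0` and make one Pieri step for each entry of `l`, ending at `k`.
A walk is indexed by all of `ℕ`; the default entry `0` keeps it constant beyond `l.length`. -/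
def pieriWalks (l : List ℕ) (k : ℕ) : Set (ℕ → ℕ) :=
  {d | d 0 = 0 ∧ (∀ i, IsPieriStep (l.getD i 0) (d i) (d (i + 1))) ∧ d l.length = k}

theorem eq_of_mem_pieriWalks {l : List ℕ} {k : ℕ} {d : ℕ → ℕ} (hd : d ∈ pieriWalks l k) {i : ℕ}
    (hi : l.length ≤ i) : d i = k := by
  induction i, hi using Nat.le_induction with
  | base => exact hd.2.2
  | succ i hi ih =>
    have hstep := hd.2.1 i
    rw [List.getD_eq_default _ _ hi, isPieriStep_zero_size] at hstep
    exact hstep.symm.trans ih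

theorem pieriWalks_nil (k : ℕ) : pieriWalks [] k = {d | d = 0 ∧ k = 0} := by
  ext d
  constructor
  · intro hd
    obtain rfl : 0 = k := hd.1.symm.trans hd.2.2
    exact ⟨funext fun i => eq_of_mem_pieriWalks hd i.zero_le, rfl⟩
  · rintro ⟨rfl, rfl⟩
    exact ⟨rfl, fun _ => isPieriStep_zero_size.2 rfl, rfl⟩

theorem mem_pieriWalks_append_singleton {l : List ℕ} {b k : ℕ} {d : ℕ → ℕ} :
    d ∈ pieriWalks (l ++ [b]) k ↔
      (fun i => d (min i l.length)) ∈ pieriWalks l (d l.length) ∧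
        IsPieriStep b (d l.length) k ∧ ∀ i, l.length < i → d i = k := by
  have hlast : (l ++ [b]).getD l.length 0 = b := by simp
  have hlen : (l ++ [b]).length = l.length + 1 := by simp
  constructor
  · intro hd
    have hconst (i : ℕ) (hi : l.length < i) : d i = k := eq_of_mem_pieriWalks hd (by omega)
    refine ⟨⟨by simpa using hd.1, fun i => ?_, by simp⟩, ?_, hconst⟩
    · rcases lt_or_ge i l.length with hi | hi
      · have hstep := hd.2.1 i
        rw [List.getD_append _ _ _ _ hi] at hstep
        simpa only [min_eq_left hi.le, min_eq_left (Nat.succ_le_of_lt hi)] using hstep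
      · simp only [List.getD_eq_default _ _ hi, isPieriStep_zero_size, min_eq_right hi,
          min_eq_right (Nat.le_succ_of_le hi)]
    · have hstep := hd.2.1 l.length
      rwa [hlast, hconst _ (Nat.lt_succ_self _)] at hstep
  · rintro ⟨⟨hzero, hsteps, -⟩, hb, hconst⟩
    refine ⟨by simpa using hzero, fun i => ?_, hconst _ (by omega)⟩
    rcases lt_trichotomy i l.length with hi | rfl | hi
    · have hstep := hsteps i
      rw [← List.getD_append _ [b] _ _ hi] at hstep
      simpa only [min_eq_left hi.le, min_eq_left (Nat.succ_le_of_lt hi)] using hstep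
    · rwa [hlast, hconst _ (Nat.lt_succ_self _)]
    · rw [List.getD_eq_default _ _ (by omega), isPieriStep_zero_size, hconst i hi,
        hconst (i + 1) (by omega)]

theorem image_pieriWalks_append_singleton (l : List ℕ) (b k : ℕ) :
    (fun d i => d (min i l.length)) '' pieriWalks (l ++ [b]) k =
      ⋃ j ∈ (Finset.range (k + b + 1)).filter (IsPieriStep b · k), pieriWalks l j := by
  ext d
  simp only [Set.mem_image, Set.mem_iUnion, exists_prop, mem_filter_isPieriStep]
  constructor
  · rintro ⟨d, hd, rfl⟩
    obtain ⟨hwalk, hb, -⟩ := mem_pieriWalks_append_singleton.1 hd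
    exact ⟨_, hb, hwalk⟩
  · rintro ⟨j, hb, hd⟩
    have hrestrict :
        (fun i => if min i l.length ≤ l.length then d (min i l.length) else k) = d := by
      funext i
      rw [if_pos (min_le_right _ _)]
      rcases le_total i l.length with hi | hi
      · rw [min_eq_left hi]
      · rw [min_eq_right hi, hd.2.2, eq_of_mem_pieriWalks hd hi]
    refine ⟨fun i => if i ≤ l.length then d i else k, ?_, hrestrict⟩
    rw [mem_pieriWalks_append_singleton]
    rw [hrestrict, if_pos le_rfl, hd.2.2]
    exact ⟨hd, hb, fun i hi => if_neg hi.not_ge⟩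

theorem injOn_pieriWalks_append_singleton (l : List ℕ) (b k : ℕ) :
    Set.InjOn (fun (d : ℕ → ℕ) i => d (min i l.length)) (pieriWalks (l ++ [b]) k) := by
  intro d hd d' hd' h
  funext i
  rcases le_or_gt i l.length with hi | hi
  · simpa only [min_eq_left hi] using congrFun h i
  · rw [(mem_pieriWalks_append_singleton.1 hd).2.2 i hi,
      (mem_pieriWalks_append_singleton.1 hd').2.2 i hi]

theorem encard_pieriWalks (l : List ℕ) (k : ℕ) : (pieriWalks l k).encard = pieriCount l k := by
  induction l using List.reverseRecOn generalizing k with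
  | nil =>
    rw [pieriWalks_nil]
    by_cases hk : k = 0 <;> simp [pieriCount, hk]
  | append_singleton l b ih =>
    have hdisj : Set.PairwiseDisjoint
        (((Finset.range (k + b + 1)).filter (IsPieriStep b · k) : Finset ℕ) : Set ℕ)
        (pieriWalks l) := fun i _ j _ hij =>
      Set.disjoint_left.2 fun _ hi hj => hij (hi.2.2.symm.trans hj.2.2)
    rw [← (injOn_pieriWalks_append_singleton l b k).encard_image,
      image_pieriWalks_append_singleton, pieriCount_append_singleton, pieriSum, Nat.cast_sum]
    refine ((Finset.finite_toSet _).encard_biUnion hdisj).trans ?_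
    rw [finsum_mem_coe_finset]
    exact Finset.sum_congr rfl fun j _ => ih j

theorem sum_take_add_one (l : List ℕ) (i : ℕ) :
    (l.take (i + 1)).sum = (l.take i).sum + l.getD i 0 := by
  rw [List.take_add_one, List.sum_append, List.getD_eq_getElem?_getD]
  cases l[i]? <;> simp

theorem two_dvd_add_and_le_of_mem_pieriWalks {l : List ℕ} {k : ℕ} {d : ℕ → ℕ}
    (hd : d ∈ pieriWalks l k) (i : ℕ) :
    2 ∣ (l.take i).sum + d i ∧ d i ≤ (l.take i).sum := by
  induction i with
  | zero => simp [hd.1]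
  | succ i ih =>
    have hstep := hd.2.1 i
    unfold IsPieriStep at hstep
    rw [sum_take_add_one]
    omega

/-! ### Row counts of two-row tableaux -/

/-- The number of entries `< i` in row `r` of a two-row tableau, that is, the length of row `r` of
the shape formed by these entries. -/
def rowCount {N : ℕ} (T : SemistandardYoungTableau (twoRowDiagram N)) (r i : ℕ) : ℕ :=
  ((Finset.range N).filter fun j => T r j < i).card

theorem twoRowDiagram_cells (N : ℕ) :
    (twoRowDiagram N).cells = Finset.range 2 ×ˢ Finset.range N := by
  ext ⟨i, j⟩
  rw [YoungDiagram.mem_cells, mem_twoRowDiagram, Finset.mem_product, Finset.mem_range,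
    Finset.mem_range]

theorem lt_card_filter_range_iff {N j : ℕ} {p : ℕ → Prop} [DecidablePred p]
    (hp : ∀ i k, i ≤ k → k < N → p k → p i) (hj : j < N) :
    j < ((Finset.range N).filter p).card ↔ p j := by
  constructor
  · contrapose!
    intro hpj
    have hsub : (Finset.range N).filter p ⊆ Finset.range j := by
      intro k hk
      rw [Finset.mem_filter, Finset.mem_range] at hk
      exact Finset.mem_range.2 (lt_of_not_ge fun hjk => hpj (hp j k hjk hk.1 hk.2))
    simpa using Finset.card_le_card hsub
  · intro hpj
    have hsub : Finset.range (j + 1) ⊆ (Finset.range N).filter p := by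
      intro i hi
      rw [Finset.mem_range] at hi
      exact Finset.mem_filter.2 ⟨Finset.mem_range.2 (by omega), hp i j (by omega) hj hpj⟩
    simpa using Finset.card_le_card hsub

section rowCount

variable {N : ℕ} (T : SemistandardYoungTableau (twoRowDiagram N))

theorem rowCount_zero (r : ℕ) : rowCount T r 0 = 0 := by
  simp [rowCount]

theorem rowCount_le (r i : ℕ) : rowCount T r i ≤ N :=
  (Finset.card_filter_le _ _).trans_eq (Finset.card_range N)

theorem rowCount_mono (r : ℕ) : Monotone (rowCount T r) := fun _ _ hik =>
  Finset.card_le_card (Finset.monotone_filter_right _ fun _ _ hj => lt_of_lt_of_le hj hik)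

theorem rowCount_one_succ_le (i : ℕ) : rowCount T 1 (i + 1) ≤ rowCount T 0 i := by
  refine Finset.card_le_card fun j hj => ?_
  simp only [Finset.mem_filter, Finset.mem_range] at hj ⊢
  have := T.col_strict Nat.zero_lt_one (mem_twoRowDiagram.2 ⟨Nat.one_lt_two, hj.1⟩)
  omega

theorem lt_rowCount_iff {r j : ℕ} (hr : r < 2) (hj : j < N) (i : ℕ) :
    j < rowCount T r i ↔ T r j < i :=
  lt_card_filter_range_iff (p := fun j => T r j < i)
    (fun _ _ hjk hk => (T.row_weak_of_le hjk (mem_twoRowDiagram.2 ⟨hr, hk⟩)).trans_lt) hj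

theorem rowCount_succ (r i : ℕ) :
    rowCount T r (i + 1) =
      rowCount T r i + ((Finset.range N).filter fun j => T r j = i).card := by
  simp only [rowCount, Nat.lt_succ_iff_lt_or_eq, Finset.filter_or]
  exact Finset.card_union_of_disjoint
    (Finset.disjoint_filter.2 fun _ _ hlt heq => hlt.ne heq)

theorem card_cells_filter_eq (i : ℕ) :
    ((twoRowDiagram N).cells.filter fun c => T c.1 c.2 = i).card =
      ((Finset.range N).filter fun j => T 0 j = i).card +
        ((Finset.range N).filter fun j => T 1 j = i).card := by
  simp only [twoRowDiagram_cells, Finset.card_filter, Finset.sum_product, Finset.sum_range_succ,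
    Finset.sum_range_zero, zero_add]

theorem hasContent_iff_rowCount {l : List ℕ} :
    HasContent T l ↔ ∀ i, rowCount T 0 i + rowCount T 1 i = (l.take i).sum := by
  simp only [HasContent, card_cells_filter_eq]
  constructor
  · intro h i
    induction i with
    | zero => simp [rowCount_zero]
    | succ i ih =>
      rw [sum_take_add_one, ← ih, ← h i, rowCount_succ, rowCount_succ]
      exact add_add_add_comm _ _ _ _
  · intro h i
    have hsucc := h (i + 1)
    rw [sum_take_add_one, ← h i, rowCount_succ, rowCount_succ] at hsucc
    omega

variable {T}

theorem eq_of_rowCount_eq {T' : SemistandardYoungTableau (twoRowDiagram N)}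
    (h : ∀ r < 2, ∀ i, rowCount T r i = rowCount T' r i) : T = T' := by
  ext r j
  by_cases hc : r < 2 ∧ j < N
  · refine eq_of_forall_gt_iff fun i => ?_
    rw [← lt_rowCount_iff T hc.1 hc.2, ← lt_rowCount_iff T' hc.1 hc.2, h r hc.1]
  · rw [T.zeros (by rwa [mem_twoRowDiagram]), T'.zeros (by rwa [mem_twoRowDiagram])]

end rowCount

/-- The properties that characterize the functions `rowCount` of the tableaux of shape `(N, N)` with
letters `< m`; `col_le` says that the columns increase strictly. -/
structure IsRowCounts (N m : ℕ) (S : ℕ → ℕ → ℕ) : Prop where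
  mono (r : ℕ) : Monotone (S r)
  zero (r : ℕ) : S r 0 = 0
  eq_of_le (r : ℕ) {i : ℕ} (hi : m ≤ i) : S r i = N
  col_le (i : ℕ) : S 1 (i + 1) ≤ S 0 i

namespace IsRowCounts

variable {N m : ℕ} {S : ℕ → ℕ → ℕ}

theorem le (hS : IsRowCounts N m S) (r i : ℕ) : S r i ≤ N :=
  (hS.mono r (le_max_left i m)).trans_eq (hS.eq_of_le r (le_max_right i m))

theorem le_findGreatest_iff (hS : IsRowCounts N m S) {r j : ℕ} (hj : j < N) (i : ℕ) :
    i ≤ Nat.findGreatest (S r · ≤ j) m ↔ S r i ≤ j := by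
  have hzero : S r 0 ≤ j := (hS.zero r).trans_le j.zero_le
  constructor
  · intro h
    exact (hS.mono r h).trans (Nat.findGreatest_spec (P := (S r · ≤ j)) m.zero_le hzero)
  · intro h
    refine Nat.le_findGreatest (le_of_not_ge fun hi => ?_) h
    rw [hS.eq_of_le r hi] at h
    exact absurd hj h.not_gt

/-- The tableau with the given row counts: the entry in column `j` is the largest `i` for which at
most `j` entries of the row are `< i`. -/
def tableau (hS : IsRowCounts N m S) : SemistandardYoungTableau (twoRowDiagram N) where
  entry r j := if r < 2 ∧ j < N then Nat.findGreatest (S r · ≤ j) m else 0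
  row_weak' := by
    intro r j k hjk hk
    rw [mem_twoRowDiagram] at hk
    rw [if_pos hk, if_pos ⟨hk.1, hjk.trans hk.2⟩, hS.le_findGreatest_iff hk.2]
    exact ((hS.le_findGreatest_iff (hjk.trans hk.2) _).1 le_rfl).trans hjk.le
  col_strict' := by
    intro r s j hrs hs
    rw [mem_twoRowDiagram] at hs
    obtain ⟨rfl, rfl⟩ : r = 0 ∧ s = 1 := by omega
    rw [if_pos hs, if_pos ⟨Nat.two_pos, hs.2⟩, ← Nat.succ_le_iff, hS.le_findGreatest_iff hs.2]
    exact (hS.col_le _).trans ((hS.le_findGreatest_iff hs.2 _).1 le_rfl)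
  zeros' := fun h => if_neg (mt mem_twoRowDiagram.2 h)

theorem tableau_lt_iff (hS : IsRowCounts N m S) {r j : ℕ} (hr : r < 2) (hj : j < N) (i : ℕ) :
    hS.tableau r j < i ↔ j < S r i := by
  rw [show hS.tableau r j = Nat.findGreatest (S r · ≤ j) m from if_pos ⟨hr, hj⟩, ← not_le,
    hS.le_findGreatest_iff hj, not_le]

theorem rowCount_tableau (hS : IsRowCounts N m S) {r : ℕ} (hr : r < 2) (i : ℕ) :
    rowCount hS.tableau r i = S r i := by
  refine eq_of_forall_lt_iff fun j => ?_
  rcases lt_or_ge j N with hj | hj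
  · rw [lt_rowCount_iff _ hr hj, hS.tableau_lt_iff hr hj]
  · exact iff_of_false ((rowCount_le _ r i).trans hj).not_gt ((hS.le r i).trans hj).not_gt

end IsRowCounts

/-- The difference of the row lengths of the shape formed by the entries `< i`. The subtraction
never truncates, by `rowCount_one_le_zero`. -/
def rowDifference {N : ℕ} (T : SemistandardYoungTableau (twoRowDiagram N)) (i : ℕ) : ℕ :=
  rowCount T 0 i - rowCount T 1 i

theorem rowCount_one_le_zero {N : ℕ} (T : SemistandardYoungTableau (twoRowDiagram N)) (i : ℕ) :
    rowCount T 1 i ≤ rowCount T 0 i :=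
  (rowCount_mono T 1 i.le_succ).trans (rowCount_one_succ_le T i)

theorem rowDifference_mem_pieriWalks {l : List ℕ}
    {T : SemistandardYoungTableau (twoRowDiagram (l.sum / 2))} (hT : HasContent T l) :
    rowDifference T ∈ pieriWalks l 0 := by
  rw [hasContent_iff_rowCount] at hT
  refine ⟨by simp [rowDifference, rowCount_zero], fun i => ?_, ?_⟩
  · have hcur := hT i
    have hnext := hT (i + 1)
    rw [sum_take_add_one] at hnext
    have htop := rowCount_mono T 0 (Nat.le_add_right i 1)
    have hbottom := rowCount_mono T 1 (Nat.le_add_right i 1)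
    have hcol := rowCount_one_succ_le T i
    unfold IsPieriStep rowDifference
    omega
  · have htotal := hT l.length
    rw [List.take_length] at htotal
    have htop := rowCount_le T 0 l.length
    unfold rowDifference
    omega

theorem injOn_rowDifference (l : List ℕ) : Set.InjOn rowDifference (kostkaTableaux l) := by
  intro T hT T' hT' h
  have hcounts (i : ℕ) : rowCount T 0 i = rowCount T' 0 i ∧ rowCount T 1 i = rowCount T' 1 i := by
    have hsum := (hasContent_iff_rowCount T).1 hT i
    have hsum' := (hasContent_iff_rowCount T').1 hT' i
    have hdiff : rowCount T 0 i - rowCount T 1 i = rowCount T' 0 i - rowCount T' 1 i := congrFun h i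
    have hle := rowCount_one_le_zero T i
    have hle' := rowCount_one_le_zero T' i
    omega
  refine eq_of_rowCount_eq fun r hr i => ?_
  obtain rfl | rfl : r = 0 ∨ r = 1 := by omega
  exacts [(hcounts i).1, (hcounts i).2]

/-- The row counts of the tableau of content `l` whose row differences are `d`, from the sum
`(l.take i).sum` and the difference `d i` of the two row counts. -/
def walkRowCounts (l : List ℕ) (d : ℕ → ℕ) (r i : ℕ) : ℕ :=
  if r = 0 then ((l.take i).sum + d i) / 2 else ((l.take i).sum - d i) / 2

theorem isRowCounts_walkRowCounts {l : List ℕ} {d : ℕ → ℕ} (hd : d ∈ pieriWalks l 0) :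
    IsRowCounts (l.sum / 2) l.length (walkRowCounts l d) where
  mono r := monotone_nat_of_le_succ fun i => by
    have hstep := hd.2.1 i
    have hle := (two_dvd_add_and_le_of_mem_pieriWalks hd i).2
    unfold IsPieriStep at hstep
    unfold walkRowCounts
    rw [sum_take_add_one]
    split_ifs <;> omega
  zero r := by simp [walkRowCounts, hd.1]
  eq_of_le r i hi := by
    simp [walkRowCounts, List.take_of_length_le hi, eq_of_mem_pieriWalks hd hi]
  col_le i := by
    have hstep := hd.2.1 i
    unfold IsPieriStep at hstep
    rw [walkRowCounts, walkRowCounts, if_neg one_ne_zero, if_pos rfl, sum_take_add_one]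
    omega

theorem surjOn_rowDifference (l : List ℕ) :
    Set.SurjOn rowDifference (kostkaTableaux l) (pieriWalks l 0) := by
  intro d hd
  have hS := isRowCounts_walkRowCounts hd
  have htop (i : ℕ) : rowCount hS.tableau 0 i = ((l.take i).sum + d i) / 2 :=
    hS.rowCount_tableau Nat.two_pos i
  have hbottom (i : ℕ) : rowCount hS.tableau 1 i = ((l.take i).sum - d i) / 2 :=
    hS.rowCount_tableau Nat.one_lt_two i
  refine ⟨hS.tableau, (hasContent_iff_rowCount _).2 fun i => ?_, funext fun i => ?_⟩
  · have := two_dvd_add_and_le_of_mem_pieriWalks hd i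
    rw [htop, hbottom]
    omega
  · have := two_dvd_add_and_le_of_mem_pieriWalks hd i
    rw [rowDifference, htop, hbottom]
    omega

theorem kostka_eq_pieriCount (l : List ℕ) : kostka l = pieriCount l 0 := by
  have hbij : Set.BijOn rowDifference (kostkaTableaux l) (pieriWalks l 0) :=
    ⟨fun _ => rowDifference_mem_pieriWalks, injOn_rowDifference l, surjOn_rowDifference l⟩
  rw [kostka, hbij.ncard_eq, Set.ncard, encard_pieriWalks, ENat.toNat_natCast]

theorem kostka_append_singleton (l : List ℕ) (b : ℕ) : kostka (l ++ [b]) = pieriCount l b := by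
  rw [kostka_eq_pieriCount, pieriCount_append_singleton, pieriSum_zero_right]

theorem kostka_append_pair (l : List ℕ) (b c : ℕ) :
    kostka (l ++ [b, c]) = pieriSum b (pieriCount l) c := by
  rw [List.append_cons, kostka_append_singleton, pieriCount_append_singleton]

theorem lemmaL_general {a μ b c : ℕ} (hμ : 2 ≤ μ) (hbc : 2 < b * c)
    (hpar : Even (μ * a + (b + c))) (hb : b ≤ c + μ * a) (hc : c ≤ b + μ * a) :
    kostka (List.replicate μ a ++ [b + c + 2]) < kostka (List.replicate μ a ++ [b, c]) := by
  rw [kostka_append_singleton, kostka_append_pair, add_comm b c]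
  exact pieriCount_replicate_add_two_lt hμ hbc hpar hb hc

theorem lemmaL (a μ : ℕ) (ha : 3 ≤ a) (hμ : 2 ≤ μ) (heven : Even (a * μ)) :
    kostka (List.replicate μ a ++ [2 * a]) <
      kostka (List.replicate μ a ++ [a - 1, a - 1]) := by
  have hbc : 2 * 2 ≤ (a - 1) * (a - 1) := Nat.mul_le_mul (by omega) (by omega)
  rw [show 2 * a = a - 1 + (a - 1) + 2 by omega]
  exact lemmaL_general hμ (by omega) ((mul_comm a μ ▸ heven).add (Even.add_self _))
    (Nat.le_add_right _ _) (Nat.le_add_right _ _)
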